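/- A magnetic graph $(b,\theta,q,m)$ over a discrete set $X$ consists of a symmetric $b:X\times X\to[0,\infty)$ with zero diagonal and $\sum_{y}b(x,y)<\infty$ for all $x$, an antisymmetric $\theta:X\times X\to\mathbb R/2\pi\mathbb Z$, a potential $q:X\to\mathbb R$ and a weight $m:X\to(0,\infty)$. Its weighted degree is $\mathrm{Deg}(x)=\frac1{m(x)}\sum_y b(x,y)+q(x)$. For finite $W\subseteq X$ put $\iota_{1,\theta}(W)=\min_{\tau:W\to\mathbb T}\frac12\sum_{x,y\in W}b(x,y)|\tau(x)-e^{i\theta(x,y)}\tau(y)|$, where $\mathbb T=\{z\in\mathbb C:|z|=1\}$, and $\partial W=(W\times (X\setminus W))\cup((X\setminus W)\times W)$. For $a,k\ge0$ the magnetic graph is $(a,k)_1$-magnetic-sparse if for all finite $W\subseteq X$ $$b(W\times W)\le(1+a)\,\iota_{1,\theta}(W)+a\Big(\tfrac12 b(\partial W)+(q_+m)(W)\Big)+k\,m(W),$$ where $q_+=\max(q,0)$ and nonnegative functions are extended to sets by summation. If $q\ge0$, then $H_\theta=H_{b,\theta,q,m}$ denotes the self-adjoint operator in $\ell^2(X,m)$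 associated with the closure in $\ell^2(X,m)$ of the form $$Q_\theta(\varphi)=\tfrac12\sum_{x,y\in X}b(x,y)|\varphi(x)-e^{i\theta(x,y)}\varphi(y)|^2+\sum_{x\in X}q(x)|\varphi(x)|^2m(x),$$ defined for finitely supported $\varphi:X\to\mathbb C$. **Theorem.** Let $(b_1,\theta_1,q_1,m_1)$ be a magnetic graph over $X_1$ with $q_1\ge0$. Let $a\ge 0$ and let $(b_2,\theta_2,q_2,m_2)$ be an $(a,0)_1$-magnetic-sparse magnetic graph over $X_2$ with $q_2\ge0$ and $\inf_{X_2}\mathrm{Deg}_2>0$. Let $\mu:X_1\times X_2\to(0,\infty)$ tend to $0$ as $(x_1,x_2)$ leaves every compact (i.e. finite) subset of $X_1\times X_2$. Define the magnetic graph $(b,\theta,q,m_\mu)$ over $X_1\times X_2$ by $$b(x,y)=b_1(x_1,y_1)m_2(x_2)1_{\{x_2=y_2\}}+b_2(x_2,y_2)m_1(x_1)1_{\{x_1=y_1\}},$$ $$\theta(x,y)=\theta_1(x_1,y_1)1_{\{x_2=y_2\}}+\theta_2(x_2,y_2)1_{\{x_1=y_1\}},$$ $$q(x)=\frac{q_1(x_1)+q_2(x_2)}{\mu(x_1,x_2)},\qquad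 m_\mu(x)=\mu(x_1,x_2)m_1(x_1)m_2(x_2).$$ Then the operator $H_\theta=H_{b,\theta,q,m_\mu}$ in $\ell^2(X_1\times X_2,m_\mu)$ has purely discrete spectrum, i.e. its spectrum consists of isolated eigenvalues of finite multiplicity. -/

import Mathlib

open MeasureTheory Filter Topology ComplexConjugate
open scoped ENNReal

/-! ### Weighted `ℓ²` spaces over a discrete set -/

/-- The measure of full support on the discrete set `X` (all subsets are measurable) induced by a
weight `m : X → (0, ∞)`: the additive extension of `{x} ↦ m x`. -/
noncomputable def weightMeasure {X : Type*} (m : X → ℝ) : @Measure X ⊤ :=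
  letI : MeasurableSpace X := ⊤
  Measure.sum fun x => ENNReal.ofReal (m x) • Measure.dirac x

/-- The complex Hilbert space `ℓ²(X, m)`. -/
noncomputable abbrev WeightedL2 {X : Type*} (m : X → ℝ) : Type _ :=
  @Lp X ℂ ⊤ _ 2 (weightMeasure m)

lemma weightMeasure_singleton {X : Type*} (m : X → ℝ) (x : X) :
    weightMeasure m {x} = ENNReal.ofReal (m x) := by
  let I : MeasurableSpace X := ⊤
  unfold weightMeasure
  rw [Measure.sum_apply _ (by trivial)]
  rw [tsum_eq_single x]
  · simp
  · intro y hy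
    simp [hy]

lemma memLp_finsupp {X : Type*} (m : X → ℝ) (φ : X →₀ ℂ) :
    @MemLp X ℂ ⊤ _ _ φ 2 (weightMeasure m) := by
  classical
  let I : MeasurableSpace X := ⊤
  induction φ using Finsupp.induction_linear with
  | zero => exact MemLp.zero
  | add f g hf hg => exact hf.add hg
  | single x c =>
    have h := @memLp_indicator_const X ℂ ⊤ (weightMeasure m) _ {x} 2
      (by trivial) c (Or.inr (by rw [weightMeasure_singleton]; exact ENNReal.ofReal_ne_top))
    convert h using 1
    ext y
    by_cases hy : y = x
    · subst hy; simp
    · simp [hy]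

/-- The inclusion of the finitely supported functions `C_c(X)` into `ℓ²(X, m)`. -/
noncomputable def finsuppToL2 {X : Type*} (m : X → ℝ) : (X →₀ ℂ) →ₗ[ℂ] WeightedL2 m where
  toFun φ := MemLp.toLp φ (memLp_finsupp m φ)
  map_add' _ _ := rfl
  map_smul' _ _ := rfl

/-! ### Magnetic graphs -/

/-- A magnetic graph `(b, θ, q, m)` over the discrete set `X`: a weighted graph `b`, a magnetic
potential `θ` with values in `ℝ / 2πℤ`, a potential `q` and a measure `m` of full support. -/
structure MagneticGraph (X : Type*) where
  /-- edge weights -/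
  b : X → X → ℝ
  /-- magnetic potential -/
  θ : X → X → Real.Angle
  /-- potential -/
  q : X → ℝ
  /-- measure -/
  m : X → ℝ
  b_nonneg : ∀ x y, 0 ≤ b x y
  b_symm : ∀ x y, b x y = b y x
  b_diag : ∀ x, b x x = 0
  b_summable : ∀ x, Summable (b x)
  θ_antisymm : ∀ x y, θ x y = -θ y x
  m_pos : ∀ x, 0 < m x

namespace MagneticGraph

/-- The weighted vertex degree `Deg(x) = (1 / m(x)) ∑_y b(x, y) + q(x)`. -/
noncomputable def Deg {X : Type*} (G : MagneticGraph X) (x : X) : ℝ :=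
  (1 / G.m x) * (∑' y, G.b x y) + G.q x

/-- The phase `e^{iθ(x, y)}`. -/
noncomputable def phase {X : Type*} (G : MagneticGraph X) (x y : X) : ℂ :=
  ((G.θ x y).toCircle : ℂ)

/-! ### Magnetic sparseness -/

/-- The `p`-frustration index of a finite set `W`; the infimum is a minimum, by compactness. -/
noncomputable def frustration {X : Type*} (G : MagneticGraph X) (p : ℝ) (W : Finset X) : ℝ :=
  ⨅ τ : W → Circle,
    (1 / 2) * ∑ x : W, ∑ y : W, G.b x y * ‖(τ x : ℂ) - G.phase x y * (τ y : ℂ)‖ ^ p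

/-- The boundary `∂W = (W × (X ∖ W)) ∪ ((X ∖ W) × W)`. -/
def boundary {X : Type*} (W : Set X) : Set (X × X) := (W ×ˢ Wᶜ) ∪ (Wᶜ ×ˢ W)

/-- `(a, k)_p`-magnetic-sparseness. -/
def IsMagneticSparse {X : Type*} (G : MagneticGraph X) (a k p : ℝ) : Prop :=
  ∀ W : Finset X,
    ∑ x ∈ W, ∑ y ∈ W, G.b x y ≤
      (1 + a) * G.frustration p W
        + a * ((1 / 2) * (∑' e : boundary (W : Set X), G.b (e : X × X).1 (e : X × X).2)
          + (∑ x ∈ W, max (G.q x) 0 * G.m x))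
        + k * ∑ x ∈ W, G.m x

/-! ### The magnetic form and the magnetic Schrödinger operator -/

/-- The magnetic difference `φ(x) - e^{iθ(x, y)} φ(y)`. -/
noncomputable def diff {X : Type*} (G : MagneticGraph X) (φ : X →₀ ℂ) (e : X × X) : ℂ :=
  φ e.1 - G.phase e.1 e.2 * φ e.2

/-- The quadratic form
`Q(φ) = ½ ∑_{x,y} b(x, y) |φ(x) - e^{iθ(x, y)} φ(y)|² + ∑_x q(x) |φ(x)|² m(x)` on `C_c(X)`. -/
noncomputable def energy {X : Type*} (G : MagneticGraph X) (φ : X →₀ ℂ) : ℝ :=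
  (1 / 2) * (∑' e : X × X, G.b e.1 e.2 * ‖G.diff φ e‖ ^ 2)
    + ∑' x, G.q x * ‖φ x‖ ^ 2 * G.m x

/-- The sesquilinear form of `Q` on `C_c(X)`, conjugate linear in the first argument. -/
noncomputable def compForm {X : Type*} (G : MagneticGraph X) (ψ φ : X →₀ ℂ) : ℂ :=
  (1 / 2) * (∑' e : X × X, (G.b e.1 e.2 : ℂ) * (conj (G.diff ψ e) * G.diff φ e))
    + ∑' x, ((G.q x * G.m x : ℝ) : ℂ) * (conj (ψ x) * φ x)

/-- The sequence `φ` in `C_c(X)` approximates `f ∈ ℓ²(X, m)` in the sense of the form: it converges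
to `f` in `ℓ²(X, m)` and it is Cauchy for the form. The domain of the closure of the form consists
of the `f` for which there is such a sequence. -/
def FormApprox {X : Type*} (G : MagneticGraph X) (φ : ℕ → X →₀ ℂ) (f : WeightedL2 G.m) : Prop :=
  Tendsto (fun n => finsuppToL2 G.m (φ n)) atTop (𝓝 f) ∧
  Tendsto (fun k : ℕ × ℕ => G.energy (φ k.1 - φ k.2)) atTop (𝓝 0)

lemma norm_phase {X : Type*} (G : MagneticGraph X) (x y : X) : ‖G.phase x y‖ = 1 := by
  exact Circle.norm_coe _

lemma diff_add {X : Type*} (G : MagneticGraph X) (φ χ : X →₀ ℂ) (e : X × X) :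
    G.diff (φ + χ) e = G.diff φ e + G.diff χ e := by
  simp [diff]; ring

lemma diff_smul {X : Type*} (G : MagneticGraph X) (c : ℂ) (φ : X →₀ ℂ) (e : X × X) :
    G.diff (c • φ) e = c * G.diff φ e := by
  simp [diff]; ring

lemma summable_left {X : Type*} (G : MagneticGraph X) (φ : X →₀ ℂ) :
    Summable fun e : X × X => G.b e.1 e.2 * ‖φ e.1‖ ^ 2 := by
  rw [summable_prod_of_nonneg]
  · refine ⟨fun x => (G.b_summable x).mul_right (‖φ x‖ ^ 2), ?_⟩
    refine summable_of_ne_finset_zero (s := φ.support) fun x hx => ?_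
    have h : φ x = 0 := by simpa using hx
    simp [h]
  · intro e
    exact mul_nonneg (G.b_nonneg _ _) (by positivity)

lemma summable_right {X : Type*} (G : MagneticGraph X) (φ : X →₀ ℂ) :
    Summable fun e : X × X => G.b e.1 e.2 * ‖φ e.2‖ ^ 2 := by
  have h := (Equiv.prodComm X X).summable_iff.mpr (G.summable_left φ)
  refine h.congr fun e => ?_
  simp [G.b_symm e.1 e.2]

lemma summable_diff_sq {X : Type*} (G : MagneticGraph X) (φ : X →₀ ℂ) :
    Summable fun e : X × X => G.b e.1 e.2 * ‖G.diff φ e‖ ^ 2 := by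
  refine Summable.of_nonneg_of_le (fun e => mul_nonneg (G.b_nonneg _ _) (by positivity)) ?_
    (((G.summable_left φ).add (G.summable_right φ)).mul_left 2)
  intro e
  have h1 : ‖G.diff φ e‖ ≤ ‖φ e.1‖ + ‖φ e.2‖ := by
    refine (norm_sub_le _ _).trans ?_
    simp [norm_phase]
  have h2 : ‖G.diff φ e‖ ^ 2 ≤ 2 * (‖φ e.1‖ ^ 2 + ‖φ e.2‖ ^ 2) := by
    nlinarith [sq_nonneg (‖φ e.1‖ - ‖φ e.2‖), norm_nonneg (G.diff φ e)]
  nlinarith [mul_le_mul_of_nonneg_left h2 (G.b_nonneg e.1 e.2)]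

lemma summable_edge {X : Type*} (G : MagneticGraph X) (ψ φ : X →₀ ℂ) :
    Summable fun e : X × X => (G.b e.1 e.2 : ℂ) * (conj (G.diff ψ e) * G.diff φ e) := by
  refine Summable.of_norm_bounded ((G.summable_diff_sq ψ).add (G.summable_diff_sq φ)) ?_
  intro e
  have hb := G.b_nonneg e.1 e.2
  rw [norm_mul, norm_mul, RCLike.norm_conj, Complex.norm_real, Real.norm_of_nonneg hb, ← mul_add]
  refine mul_le_mul_of_nonneg_left ?_ hb
  nlinarith [sq_nonneg (‖G.diff ψ e‖ - ‖G.diff φ e‖), sq_nonneg (‖G.diff ψ e‖),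
    sq_nonneg (‖G.diff φ e‖)]

lemma summable_vertex {X : Type*} (G : MagneticGraph X) (ψ φ : X →₀ ℂ) :
    Summable fun x : X => ((G.q x * G.m x : ℝ) : ℂ) * (conj (ψ x) * φ x) := by
  refine summable_of_ne_finset_zero (s := φ.support) fun x hx => ?_
  have h : φ x = 0 := by simpa using hx
  simp [h]

lemma compForm_add_right {X : Type*} (G : MagneticGraph X) (ψ φ χ : X →₀ ℂ) :
    G.compForm ψ (φ + χ) = G.compForm ψ φ + G.compForm ψ χ := by
  unfold compForm
  simp only [diff_add, Finsupp.add_apply, mul_add]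
  rw [(G.summable_edge ψ φ).tsum_add (G.summable_edge ψ χ),
    (G.summable_vertex ψ φ).tsum_add (G.summable_vertex ψ χ)]
  ring

lemma compForm_smul_right {X : Type*} (G : MagneticGraph X) (c : ℂ) (ψ φ : X →₀ ℂ) :
    G.compForm ψ (c • φ) = c * G.compForm ψ φ := by
  unfold compForm
  rw [mul_add, mul_left_comm c, ← tsum_mul_left (a := c), ← tsum_mul_left (a := c)]
  congr 1
  · congr 1
    refine tsum_congr fun e => ?_
    rw [diff_smul]; ring
  · refine tsum_congr fun x => ?_
    simp only [Finsupp.smul_apply, smul_eq_mul]; ring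

lemma compForm_conj {X : Type*} (G : MagneticGraph X) (ψ φ : X →₀ ℂ) :
    conj (G.compForm ψ φ) = G.compForm φ ψ := by
  unfold compForm
  simp only [map_add, map_mul, Complex.conj_tsum, Complex.conj_conj, Complex.conj_ofReal, map_div₀,
    map_one, map_ofNat]
  congr 1
  · congr 1
    exact tsum_congr fun e => by ring
  · exact tsum_congr fun e => by ring

lemma compForm_add_left {X : Type*} (G : MagneticGraph X) (ψ φ χ : X →₀ ℂ) :
    G.compForm (φ + χ) ψ = G.compForm φ ψ + G.compForm χ ψ := by
  rw [← compForm_conj, compForm_add_right, map_add, compForm_conj, compForm_conj]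

lemma compForm_smul_left {X : Type*} (G : MagneticGraph X) (c : ℂ) (ψ φ : X →₀ ℂ) :
    G.compForm (c • φ) ψ = conj c * G.compForm φ ψ := by
  rw [← compForm_conj, compForm_smul_right, map_mul, compForm_conj]

lemma compForm_self {X : Type*} (G : MagneticGraph X) (φ : X →₀ ℂ) :
    G.compForm φ φ = (G.energy φ : ℂ) := by
  unfold compForm energy
  push_cast
  congr 1
  · congr 1
    refine tsum_congr fun e => ?_
    rw [Complex.conj_mul']
  · refine tsum_congr fun x => ?_
    rw [Complex.conj_mul']; ring

lemma energy_nonneg {X : Type*} (G : MagneticGraph X) (hq : ∀ x, 0 ≤ G.q x) (φ : X →₀ ℂ) :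
    0 ≤ G.energy φ := by
  refine add_nonneg (mul_nonneg (by norm_num) (tsum_nonneg fun e => ?_)) (tsum_nonneg fun x => ?_)
  · exact mul_nonneg (G.b_nonneg _ _) (by positivity)
  · exact mul_nonneg (mul_nonneg (hq x) (by positivity)) (G.m_pos x).le

lemma energy_smul {X : Type*} (G : MagneticGraph X) (c : ℂ) (φ : X →₀ ℂ) :
    G.energy (c • φ) = ‖c‖ ^ 2 * G.energy φ := by
  have h : (G.energy (c • φ) : ℂ) = ((‖c‖ ^ 2 * G.energy φ : ℝ) : ℂ) := by
    rw [← compForm_self, compForm_smul_left, compForm_smul_right, compForm_self, ← mul_assoc,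
      Complex.conj_mul']
    push_cast; rfl
  exact_mod_cast h

lemma energy_add_le {X : Type*} (G : MagneticGraph X) (hq : ∀ x, 0 ≤ G.q x) (φ χ : X →₀ ℂ) :
    G.energy (φ + χ) ≤ 2 * (G.energy φ + G.energy χ) := by
  have h : (G.energy (φ + χ) + G.energy (φ + (-1 : ℂ) • χ) : ℂ)
      = ((2 * (G.energy φ + G.energy χ) : ℝ) : ℂ) := by
    push_cast
    simp only [← compForm_self, compForm_add_left, compForm_add_right, compForm_smul_left,
      compForm_smul_right, map_neg, map_one]
    ring
  have h' : G.energy (φ + χ) + G.energy (φ + (-1 : ℂ) • χ) = 2 * (G.energy φ + G.energy χ) := by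
    exact_mod_cast h
  linarith [G.energy_nonneg hq (φ + (-1 : ℂ) • χ)]

lemma FormApprox.add {X : Type*} {G : MagneticGraph X} (hq : ∀ x, 0 ≤ G.q x)
    {φ χ : ℕ → X →₀ ℂ} {f g : WeightedL2 G.m} (h : G.FormApprox φ f) (h' : G.FormApprox χ g) :
    G.FormApprox (fun n => φ n + χ n) (f + g) := by
  refine ⟨?_, ?_⟩
  · simpa using h.1.add h'.1
  · refine squeeze_zero (fun k => G.energy_nonneg hq _) (fun k => ?_)
      (by simpa using (h.2.add h'.2).const_mul 2)
    rw [add_sub_add_comm]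
    exact G.energy_add_le hq _ _

lemma FormApprox.smul {X : Type*} {G : MagneticGraph X} (c : ℂ)
    {φ : ℕ → X →₀ ℂ} {f : WeightedL2 G.m} (h : G.FormApprox φ f) :
    G.FormApprox (fun n => c • φ n) (c • f) := by
  refine ⟨?_, ?_⟩
  · simpa using h.1.const_smul c
  · have := h.2.const_mul (‖c‖ ^ 2)
    simpa [← smul_sub, energy_smul] using this

lemma FormApprox.const {X : Type*} {G : MagneticGraph X} (φ : X →₀ ℂ) :
    G.FormApprox (fun _ => φ) (finsuppToL2 G.m φ) := by
  refine ⟨tendsto_const_nhds, ?_⟩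
  simp [energy, diff]

/-- The graph of the operator associated with the closure `Q̄` of the form of a magnetic graph with
nonnegative potential: the pairs `(f, h)` in `ℓ²(X, m)` with `f` in the domain of `Q̄` and
`Q̄(g, f) = ⟨g, h⟩` for all `g` in the domain of `Q̄`, where `Q̄(g, f) = lim Q(ψ n, φ n)` for
approximating sequences `ψ` of `g` and `φ` of `f`. -/
def operatorGraph {X : Type*} (G : MagneticGraph X) (hq : ∀ x, 0 ≤ G.q x) :
    Submodule ℂ (WeightedL2 G.m × WeightedL2 G.m) where
  carrier := {u | ∃ φ : ℕ → X →₀ ℂ, G.FormApprox φ u.1 ∧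
    ∀ (g : WeightedL2 G.m) (ψ : ℕ → X →₀ ℂ), G.FormApprox ψ g →
      Tendsto (fun n => G.compForm (ψ n) (φ n)) atTop (𝓝 (inner ℂ g u.2))}
  add_mem' := by
    rintro u v ⟨φ, hφ, hu⟩ ⟨χ, hχ, hv⟩
    refine ⟨fun n => φ n + χ n, hφ.add hq hχ, fun g ψ hψ => ?_⟩
    simpa [compForm_add_right, inner_add_right] using (hu g ψ hψ).add (hv g ψ hψ)
  zero_mem' := by
    refine ⟨fun _ => 0, by simpa using FormApprox.const (G := G) 0, fun g ψ hψ => ?_⟩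
    simp [compForm, diff]
  smul_mem' := by
    rintro c u ⟨φ, hφ, hu⟩
    refine ⟨fun n => c • φ n, hφ.smul c, fun g ψ hψ => ?_⟩
    simpa [compForm_smul_right, inner_smul_right] using (hu g ψ hψ).const_mul c

/-- The magnetic Schrödinger operator `H_θ` in `ℓ²(X, m)` of a magnetic graph with nonnegative
potential: the operator associated with the closure of the form. -/
noncomputable def hamiltonian {X : Type*} (G : MagneticGraph X) (hq : ∀ x, 0 ≤ G.q x) :
    WeightedL2 G.m →ₗ.[ℂ] WeightedL2 G.m :=
  (G.operatorGraph hq).toLinearPMap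

/-! The graph above is the graph of an operator, since the form is closable. -/

lemma ae_weightMeasure {X : Type*} {m : X → ℝ} (hm : ∀ x, 0 < m x) {p : X → Prop}
    (h : ∀ᵐ x ∂(weightMeasure m), p x) (x : X) : p x := by
  by_contra hx
  have h0 : weightMeasure m {x} = 0 :=
    measure_mono_null (fun y hy => by rw [Set.mem_singleton_iff] at hy; subst hy; exact hx)
      (ae_iff.mp h)
  rw [weightMeasure_singleton, ENNReal.ofReal_eq_zero] at h0
  exact absurd (hm x) (not_lt.mpr h0)

lemma tendsto_apply {X : Type*} {m : X → ℝ} (hm : ∀ x, 0 < m x) {φ : ℕ → X →₀ ℂ}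
    (h : Tendsto (fun n => finsuppToL2 m (φ n)) atTop (𝓝 0)) (x : X) :
    Tendsto (fun n => φ n x) atTop (𝓝 0) := by
  have h1 := tendstoInMeasure_of_tendsto_Lp h
  rw [Metric.tendsto_atTop]
  intro ε hε
  have h2 := h1 (ENNReal.ofReal ε) (by simpa using hε)
  have h3 := (h2.eventually_lt_const (show 0 < weightMeasure m {x} by
    rw [weightMeasure_singleton]; simpa using hm x))
  obtain ⟨N, hN⟩ := eventually_atTop.mp h3
  refine ⟨N, fun n hn => ?_⟩
  by_contra hc
  refine absurd (hN n hn) (not_lt.mpr (measure_mono ?_))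
  rintro y hy
  rw [Set.mem_singleton_iff] at hy
  subst hy
  have e1 : (finsuppToL2 m (φ n) : X → ℂ) y = φ n y :=
    ae_weightMeasure hm (MemLp.coeFn_toLp (memLp_finsupp m (φ n))) y
  have e2 : ((0 : WeightedL2 m) : X → ℂ) y = 0 := ae_weightMeasure hm (Lp.coeFn_zero _ _ _) y
  simp only [Set.mem_ofPred_eq, e1, e2, edist_dist]
  exact ENNReal.ofReal_le_ofReal (not_lt.mp hc)

lemma FormApprox.energy_tendsto {X : Type*} {G : MagneticGraph X} (hq : ∀ x, 0 ≤ G.q x)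
    {φ : ℕ → X →₀ ℂ} (h : G.FormApprox φ 0) : Tendsto (fun n => G.energy (φ n)) atTop (𝓝 0) := by
  classical
  rw [Metric.tendsto_atTop]
  intro ε hε
  have h2 := h.2.eventually_lt_const (half_pos hε)
  rw [eventually_atTop] at h2
  obtain ⟨⟨N, M⟩, hNM⟩ := h2
  have key : ∀ n, N ≤ n → G.energy (φ n) ≤ ε / 2 := by
    intro n hn
    have hs : ∀ (S : Finset (X × X)) (T : Finset X),
        (1 / 2) * (∑ e ∈ S, G.b e.1 e.2 * ‖G.diff (φ n) e‖ ^ 2)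
          + ∑ x ∈ T, G.q x * ‖φ n x‖ ^ 2 * G.m x ≤ ε / 2 := by
      intro S T
      have hl : Tendsto (fun k =>
          (1 / 2) * (∑ e ∈ S, G.b e.1 e.2 * ‖G.diff (φ n - φ k) e‖ ^ 2)
            + ∑ x ∈ T, G.q x * ‖(φ n - φ k) x‖ ^ 2 * G.m x) atTop
          (𝓝 ((1 / 2) * (∑ e ∈ S, G.b e.1 e.2 * ‖G.diff (φ n) e‖ ^ 2)
            + ∑ x ∈ T, G.q x * ‖φ n x‖ ^ 2 * G.m x)) := by
        have hp : ∀ x, Tendsto (fun k => (φ n - φ k) x) atTop (𝓝 (φ n x)) := fun x => by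
          simpa using (tendsto_apply G.m_pos h.1 x).const_sub (φ n x)
        refine Tendsto.add (Tendsto.const_mul _ (tendsto_finsetSum _ fun e _ => ?_))
          (tendsto_finsetSum _ fun x _ => ?_)
        · exact (((hp e.1).sub ((hp e.2).const_mul _)).norm.pow 2).const_mul _
        · exact (((hp x).norm.pow 2).const_mul _).mul_const _
      refine le_of_tendsto hl (eventually_atTop.mpr ⟨M, fun k hk => ?_⟩)
      refine le_trans ?_ (hNM (n, k) ⟨hn, hk⟩).le
      unfold energy
      refine add_le_add (mul_le_mul_of_nonneg_left
        ((G.summable_diff_sq _).sum_le_tsum S fun e _ => ?_) (by norm_num))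
        (Summable.sum_le_tsum T (fun x _ => ?_) ?_)
      · exact mul_nonneg (G.b_nonneg _ _) (by positivity)
      · exact mul_nonneg (mul_nonneg (hq x) (by positivity)) (G.m_pos x).le
      · refine summable_of_ne_finset_zero (s := (φ n - φ k).support) fun x hx => ?_
        have h : (φ n - φ k) x = 0 := by simpa using hx
        simp [h]
    unfold energy
    rw [tsum_eq_sum (s := (φ n).support) (f := fun x => G.q x * ‖φ n x‖ ^ 2 * G.m x)
      (fun x hx => by
        have h : φ n x = 0 := by simpa using hx
        simp [h])]
    have := Real.tsum_le_of_sum_le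
      (f := fun e : X × X => G.b e.1 e.2 * ‖G.diff (φ n) e‖ ^ 2)
      (c := 2 * (ε / 2 - ∑ x ∈ (φ n).support, G.q x * ‖φ n x‖ ^ 2 * G.m x))
      (fun e => mul_nonneg (G.b_nonneg _ _) (by positivity))
      (fun S => by linarith [hs S (φ n).support])
    linarith
  refine ⟨N, fun n hn => ?_⟩
  rw [Real.dist_eq, sub_zero, abs_of_nonneg (G.energy_nonneg hq _)]
  linarith [key n hn]

lemma norm_compForm_le {X : Type*} (G : MagneticGraph X) (hq : ∀ x, 0 ≤ G.q x)
    (ψ φ : X →₀ ℂ) : ‖G.compForm ψ φ‖ ≤ √(G.energy ψ) * √(G.energy φ) := by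
  let c : PreInnerProductSpace.Core ℂ (X →₀ ℂ) :=
    { inner := G.compForm
      conj_inner_symm := fun ψ φ => G.compForm_conj φ ψ
      re_inner_nonneg := fun φ => by
        rw [compForm_self]; exact G.energy_nonneg hq φ
      add_left := fun φ χ ψ => G.compForm_add_left ψ φ χ
      smul_left := fun φ ψ c => G.compForm_smul_left c ψ φ }
  have h := @InnerProductSpace.Core.norm_inner_le_norm ℂ (X →₀ ℂ) _ _ _ c ψ φ
  have e : ∀ χ : X →₀ ℂ, RCLike.re (G.compForm χ χ) = G.energy χ := fun χ => by
    rw [compForm_self]; rfl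
  rw [← e ψ, ← e φ]
  exact h

lemma eq_zero_of_inner {X : Type*} {m : X → ℝ} (hm : ∀ x, 0 < m x) (h : WeightedL2 m)
    (H : ∀ ψ : X →₀ ℂ, inner ℂ (finsuppToL2 m ψ) h = 0) : h = 0 := by
  let I : MeasurableSpace X := ⊤
  have hx : ∀ x, (h : X → ℂ) x = 0 := by
    intro x
    have h1 := H (Finsupp.single x 1)
    have hmx : MeasurableSet ({x} : Set X) := by trivial
    have hf : weightMeasure m {x} ≠ ∞ := by
      rw [weightMeasure_singleton]; exact ENNReal.ofReal_ne_top
    have e : finsuppToL2 m (Finsupp.single x 1)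
        = indicatorConstLp 2 (μ := weightMeasure m) hmx hf (1 : ℂ) := by
      apply Lp.ext
      refine (MemLp.coeFn_toLp (memLp_finsupp m (Finsupp.single x 1))).trans (EventuallyEq.trans (Eventually.of_forall fun y => ?_)
        indicatorConstLp_coeFn.symm)
      by_cases hy : y = x
      · subst hy; simp
      · simp [hy]
    rw [e, L2.inner_indicatorConstLp_one, integral_singleton, Measure.real,
      weightMeasure_singleton, ENNReal.toReal_ofReal (hm x).le, smul_eq_zero] at h1
    exact h1.resolve_left (hm x).ne'
  apply Lp.ext
  refine EventuallyEq.trans (Eventually.of_forall fun x => hx x) (Lp.coeFn_zero _ _ _).symm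

theorem hamiltonian_graph {X : Type*} (G : MagneticGraph X) (hq : ∀ x, 0 ≤ G.q x) :
    (G.hamiltonian hq).graph = G.operatorGraph hq := by
  refine Submodule.toLinearPMap_graph_eq _ ?_
  rintro ⟨f, h⟩ ⟨φ, hφ, hh⟩ hf
  simp only at hf hφ hh
  subst hf
  refine eq_zero_of_inner G.m_pos h fun ψ => ?_
  refine tendsto_nhds_unique (hh _ _ (FormApprox.const ψ)) ?_
  refine squeeze_zero_norm (fun n => G.norm_compForm_le hq ψ (φ n)) ?_
  simpa using ((hφ.energy_tendsto hq).sqrt).const_mul (√(G.energy ψ))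

/-! ### Products -/

open scoped Classical in
/-- The Cartesian product of two magnetic graphs with respect to a weight `μ`. -/
noncomputable def prod {X₁ X₂ : Type*} (G₁ : MagneticGraph X₁) (G₂ : MagneticGraph X₂)
    (μ : X₁ × X₂ → ℝ) (hμ : ∀ x, 0 < μ x) : MagneticGraph (X₁ × X₂) where
  b x y := G₁.b x.1 y.1 * G₂.m x.2 * (if x.2 = y.2 then 1 else 0)
    + G₂.b x.2 y.2 * G₁.m x.1 * (if x.1 = y.1 then 1 else 0)
  θ x y := (if x.2 = y.2 then G₁.θ x.1 y.1 else 0) + (if x.1 = y.1 then G₂.θ x.2 y.2 else 0)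
  q x := (1 / μ x) * (G₁.q x.1 + G₂.q x.2)
  m x := μ x * G₁.m x.1 * G₂.m x.2
  b_nonneg x y := by
    refine add_nonneg (mul_nonneg (mul_nonneg (G₁.b_nonneg _ _) (G₂.m_pos _).le) ?_)
      (mul_nonneg (mul_nonneg (G₂.b_nonneg _ _) (G₁.m_pos _).le) ?_) <;> split_ifs <;> norm_num
  b_symm x y := by
    rw [G₁.b_symm x.1 y.1, G₂.b_symm x.2 y.2]
    by_cases h1 : x.1 = y.1 <;> by_cases h2 : x.2 = y.2 <;> simp [h1, h2, eq_comm]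
  b_diag x := by simp [G₁.b_diag, G₂.b_diag]
  b_summable x := by
    refine Summable.add ?_ ?_
    · have hi : Function.Injective fun y₁ : X₁ => (y₁, x.2) := fun y z h => by simpa using h
      refine (hi.summable_iff (f := fun y : X₁ × X₂ =>
        G₁.b x.1 y.1 * G₂.m x.2 * (if x.2 = y.2 then 1 else 0)) ?_).mp ?_
      · rintro ⟨y₁, y₂⟩ hy
        have : x.2 ≠ y₂ := fun h => hy ⟨y₁, by simp [h]⟩
        simp [this]
      · refine ((G₁.b_summable x.1).mul_right (G₂.m x.2)).congr fun y => ?_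
        simp
    · have hi : Function.Injective fun y₂ : X₂ => (x.1, y₂) := fun y z h => by simpa using h
      refine (hi.summable_iff (f := fun y : X₁ × X₂ =>
        G₂.b x.2 y.2 * G₁.m x.1 * (if x.1 = y.1 then 1 else 0)) ?_).mp ?_
      · rintro ⟨y₁, y₂⟩ hy
        have : x.1 ≠ y₁ := fun h => hy ⟨y₂, by simp [h]⟩
        simp [this]
      · refine ((G₂.b_summable x.2).mul_right (G₁.m x.1)).congr fun y => ?_
        simp
  θ_antisymm x y := by
    rw [G₁.θ_antisymm x.1 y.1, G₂.θ_antisymm x.2 y.2]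
    simp only [eq_comm (a := x.1), eq_comm (a := x.2)]
    split_ifs <;> simp [add_comm]
  m_pos x := mul_pos (mul_pos (hμ x) (G₁.m_pos _)) (G₂.m_pos _)

lemma prod_q_nonneg {X₁ X₂ : Type*} {G₁ : MagneticGraph X₁} {G₂ : MagneticGraph X₂}
    (h₁ : ∀ x, 0 ≤ G₁.q x) (h₂ : ∀ x, 0 ≤ G₂.q x) {μ : X₁ × X₂ → ℝ} (hμ : ∀ x, 0 < μ x)
    (x : X₁ × X₂) : 0 ≤ (G₁.prod G₂ μ hμ).q x :=
  mul_nonneg (one_div_pos.mpr (hμ x)).le (add_nonneg (h₁ _) (h₂ _))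

end MagneticGraph

/-! ### Spectrum of an unbounded operator -/

/-- `z` is in the resolvent set of `T`: `T - z` maps the domain of `T` bijectively onto the space,
with bounded inverse `R`. -/
def LinearPMap.IsResolventPoint {E : Type*} [NormedAddCommGroup E] [NormedSpace ℂ E]
    (T : E →ₗ.[ℂ] E) (z : ℂ) : Prop :=
  ∃ R : E →L[ℂ] E,
    (∀ g : E, ∃ u : T.domain, (u : E) = R g ∧ T u - z • (u : E) = g) ∧
    (∀ u : T.domain, R (T u - z • (u : E)) = u)

/-- The spectrum of an unbounded operator. -/
def LinearPMap.unboundedSpectrum {E : Type*} [NormedAddCommGroup E] [NormedSpace ℂ E]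
    (T : E →ₗ.[ℂ] E) : Set ℂ :=
  {z | ¬ T.IsResolventPoint z}

/-- The spectrum consists of isolated eigenvalues of finite multiplicity. -/
def LinearPMap.HasPurelyDiscreteSpectrum {E : Type*} [NormedAddCommGroup E] [NormedSpace ℂ E]
    (T : E →ₗ.[ℂ] E) : Prop :=
  ∀ z ∈ T.unboundedSpectrum,
    ¬ AccPt z (𝓟 T.unboundedSpectrum) ∧
    (∃ u : T.domain, (u : E) ≠ 0 ∧ T u = z • (u : E)) ∧
    FiniteDimensional ℂ (LinearMap.ker (T.toFun - z • T.domain.subtype))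

/-! The operator has a compact inverse. If the form dominates `c ∑ (m/μ)|φ|²` and `μ` vanishes at
infinity, then bounded energy makes the `ℓ²`-mass outside a large finite set uniformly small. Hence
the embedding `J` of the energy completion of `C_c(X)` into `ℓ²(X, m)` is a norm limit of
finite-rank operators. The operator of the closed form is the inverse of `J J*`
(`mem_operatorGraph_iff`), and its spectrum consists of reciprocals of nonzero eigenvalues of this
compact symmetric operator.

For the product, `m_μ/μ = m₁ m₂`, so the required bound is a spectral gap of the second factor,
applied on each fiber `{x₁} × X₂` and summed with weight `m₁` (`prod_form_bound`). The edges and the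
potential of the first factor only add nonnegative terms.

The gap comes from sparseness with `k = 0`. Let `τ` be the phase of `φ` and `w(x,y) = |τ(x) -
e^{iθ(x,y)} τ(y)|`. Since `½ b(∂W) = ∑_{x∈W} ∑_y b(x,y) - b(W×W)`, sparseness reads `(1+a) ∑_{W×W} b
(1 - w/2) ≤ a ∑_{x∈W} (∑_y b(x,y) + q m)`. A co-area argument (`Finset.sum_min_le_of_forall_subset`)
replaces the indicator of `W` by `|φ|²`, with the minimum of the two values on an edge. The
elementary inequality `half_add_sq_le` replaces that minimum by the mean, at the price of an error
which Young's inequality splits into energy and a small multiple of the degree term. As `1+a` stands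
against `a`, one copy of the degree term is left over, and the error consumes only half of it. A
lower bound on `Deg` then gives the gap. -/

/-! ### Operators with compact symmetric inverse -/

section CompactInverse

variable {E : Type*} [NormedAddCommGroup E] [InnerProductSpace ℂ E]

/-- A compact symmetric operator has only finitely many eigenvalues away from zero. -/
lemma IsCompactOperator.finite_eigenvalues_of_le_norm {R : E →L[ℂ] E} (hR : IsCompactOperator R)
    (hs : (R : E →ₗ[ℂ] E).IsSymmetric) {ε : ℝ} (hε : 0 < ε) :
    {z : ℂ | Module.End.HasEigenvalue (R : E →ₗ[ℂ] E) z ∧ ε ≤ ‖z‖}.Finite := by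
  by_contra hinf
  let f := (show Set.Infinite _ from hinf).natEmbedding
  have hex : ∀ n, ∃ e : E, ‖e‖ = 1 ∧ R e = (f n : ℂ) • e := fun n => by
    obtain ⟨v, hv⟩ := (f n).2.1.exists_hasEigenvector
    have hv0 : ‖v‖ ≠ 0 := norm_ne_zero_iff.mpr hv.2
    have hv1 : R v = (f n : ℂ) • v := hv.apply_eq_smul
    refine ⟨((‖v‖ : ℂ)⁻¹) • v, ?_, ?_⟩
    · rw [norm_smul, norm_inv, Complex.norm_real, norm_norm, inv_mul_cancel₀ hv0]
    · rw [map_smul, hv1, smul_comm]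
  choose e he hRe using hex
  have horth : ∀ i j, i ≠ j → inner ℂ (e i) (e j) = 0 := fun i j hij => by
    have h := hs.orthogonalFamily_eigenspaces
      (i := (f i : ℂ)) (j := (f j : ℂ)) (fun h => hij (f.injective (Subtype.ext h)))
      ⟨e i, Module.End.mem_eigenspace_iff.mpr (hRe i)⟩
      ⟨e j, Module.End.mem_eigenspace_iff.mpr (hRe j)⟩
    simpa using h
  obtain ⟨K, hK, hK'⟩ := hR.image_closedBall_subset_compact (f := (R : E →ₗ[ℂ] E)) 1
  obtain ⟨y, -, ψ, hψ, hy⟩ := hK.tendsto_subseq (x := fun n => R (e n))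
    (fun n => hK' ⟨e n, by simp [he], rfl⟩)
  have hc := hy.cauchySeq
  rw [Metric.cauchySeq_iff] at hc
  obtain ⟨N, hN⟩ := hc ε hε
  -- Two terms of the convergent subsequence are closer than `ε`, but they are orthogonal vectors of
  -- norm at least `ε`, contradicting Pythagoras.
  have hd := hN N le_rfl (N + 1) (by lia)
  have hne : ψ N ≠ ψ (N + 1) := (hψ (by lia : N < N + 1)).ne
  simp only [Function.comp, dist_eq_norm, hRe] at hd
  have h0 : inner ℂ ((f (ψ N) : ℂ) • e (ψ N)) ((f (ψ (N + 1)) : ℂ) • e (ψ (N + 1))) = 0 := by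
    rw [inner_smul_left, inner_smul_right, horth _ _ hne]; simp
  have h1 := norm_sub_sq (𝕜 := ℂ) ((f (ψ N) : ℂ) • e (ψ N)) ((f (ψ (N + 1)) : ℂ) • e (ψ (N + 1)))
  rw [h0, norm_smul, norm_smul, he, he] at h1
  have h2 := (f (ψ N)).2.2
  simp only [map_zero, mul_zero, sub_zero, mul_one] at h1
  nlinarith [norm_nonneg ((f (ψ N) : ℂ) • e (ψ N) - (f (ψ (N + 1)) : ℂ) • e (ψ (N + 1))),
    sq_nonneg ‖(f (ψ (N + 1)) : ℂ)‖]

/-- An operator whose inverse `R` is everywhere defined, compact and symmetric has purely discrete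
spectrum. -/
theorem LinearPMap.hasPurelyDiscreteSpectrum_of_compact_inverse [CompleteSpace E]
    {T : E →ₗ.[ℂ] E} {R : E →L[ℂ] E} (hR : IsCompactOperator R)
    (hs : (R : E →ₗ[ℂ] E).IsSymmetric) (hT : ∀ f h, (f, h) ∈ T.graph ↔ f = R h) :
    T.HasPurelyDiscreteSpectrum := by
  have hdom : ∀ h, ∃ u : T.domain, (u : E) = R h ∧ T u = h := fun h => by
    simpa using (T.mem_graph_iff).mp ((hT (R h) h).mpr rfl)
  have hinv : ∀ u : T.domain, (u : E) = R (T u) := fun u => (hT _ _).mp (T.mem_graph u)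
  have hspec : ∀ z ∈ T.unboundedSpectrum,
      z ≠ 0 ∧ Module.End.HasEigenvalue (R : E →ₗ[ℂ] E) z⁻¹ := by
    intro z hz
    -- On the domain `T - z = (1 - z R) T`, so an inverse of `1 - z R` would make `R (1 - z R)⁻¹`
    -- the resolvent at `z`.
    have hunit : ¬ IsUnit (1 - z • R) := by
      rintro ⟨U, hU⟩
      have h1 : ∀ x, (↑U⁻¹ : E →L[ℂ] E) x - z • R ((↑U⁻¹ : E →L[ℂ] E) x) = x := fun x => by
        have := congrArg (fun A : E →L[ℂ] E => A x) U.mul_inv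
        rw [hU] at this
        simpa using this
      have h2 : ∀ x, (↑U⁻¹ : E →L[ℂ] E) (x - z • R x) = x := fun x => by
        have := congrArg (fun A : E →L[ℂ] E => A x) U.inv_mul
        rw [hU] at this
        simpa using this
      refine hz ⟨R * (↑U⁻¹ : E →L[ℂ] E), fun g => ?_, fun u => ?_⟩
      · obtain ⟨u, hu, hTu⟩ := hdom ((↑U⁻¹ : E →L[ℂ] E) g)
        exact ⟨u, hu, by rw [hTu, hu]; exact h1 g⟩
      · have : T u - z • (u : E) = T u - z • R (T u) := by rw [← hinv u]
        rw [this, mul_apply_eq_comp, h2, ← hinv u]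
    have hz0 : z ≠ 0 := by
      rintro rfl
      simp at hunit
    refine ⟨hz0, (hR.hasEigenvalue_or_mem_resolventSet (inv_ne_zero hz0)).resolve_right ?_⟩
    intro hr
    refine hunit ?_
    rw [spectrum.mem_resolventSet_iff] at hr
    have : (1 - z • R) = z • (algebraMap ℂ (E →L[ℂ] E) z⁻¹ - R) := by
      rw [smul_sub, Algebra.algebraMap_eq_smul_one, smul_smul, mul_inv_cancel₀ hz0, one_smul]
    rw [this]
    exact hr.smul (Units.mk0 z hz0)
  intro z hz
  obtain ⟨hz0, hev⟩ := hspec z hz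
  refine ⟨fun hacc => ?_, ?_, ?_⟩
  -- Spectral points within distance one of `z` have modulus below `‖z‖ + 1`, so their reciprocals
  -- are eigenvalues of `R` bounded away from zero.
  · have hfin := (hR.finite_eigenvalues_of_le_norm hs
      (inv_pos.mpr (by positivity : 0 < ‖z‖ + 1))).preimage
        (f := fun w : ℂ => w⁻¹) (inv_injective.injOn)
    have h := hacc.nhds_inter (Metric.ball_mem_nhds z one_pos)
    refine Set.Infinite.of_accPt h (hfin.subset ?_)
    rintro w ⟨hw, hwT⟩
    obtain ⟨hw0, hwe⟩ := hspec w hwT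
    refine ⟨hwe, ?_⟩
    rw [norm_inv]
    refine inv_anti₀ (norm_pos_iff.mpr hw0) ?_
    have := norm_sub_norm_le w z
    rw [mem_ball_iff_norm] at hw
    linarith
  · obtain ⟨v, hv⟩ := hev.exists_hasEigenvector
    have hv1 : R v = z⁻¹ • v := hv.apply_eq_smul
    obtain ⟨u, hu, hTu⟩ := hdom v
    refine ⟨u, ?_, ?_⟩
    · rw [hu, hv1]; exact smul_ne_zero (inv_ne_zero hz0) hv.2
    · rw [hTu, hu, hv1, smul_smul, mul_inv_cancel₀ hz0, one_smul]
  · have : FiniteDimensional ℂ (Module.End.eigenspace (R : E →ₗ[ℂ] E) z⁻¹) :=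
      ContinuousLinearMap.finite_dimensional_eigenspace hR _ (inv_ne_zero hz0)
    let L : LinearMap.ker (T.toFun - z • T.domain.subtype) →ₗ[ℂ]
        Module.End.eigenspace (R : E →ₗ[ℂ] E) z⁻¹ :=
      (T.domain.subtype ∘ₗ Submodule.subtype _).codRestrict _ fun u => by
        have hu : T (u : T.domain) = z • ((u : T.domain) : E) := by
          have := u.2
          rw [LinearMap.mem_ker, LinearMap.sub_apply, sub_eq_zero] at this
          exact this
        have h := hinv u
        rw [hu] at h
        rw [Module.End.mem_eigenspace_iff]
        change R ((u : T.domain) : E) = z⁻¹ • ((u : T.domain) : E)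
        rw [eq_inv_smul_iff₀ hz0]
        exact (R.map_smul z _).symm.trans h.symm
    refine FiniteDimensional.of_injective L fun u v huv => ?_
    exact Subtype.ext (Subtype.ext (congrArg Subtype.val huv :))

end CompactInverse

/-! ### The form domain and its embedding into `ℓ²` -/

section WeightedL2

variable {X : Type*} {m : X → ℝ}

lemma inner_finsuppToL2_single (hm : ∀ x, 0 < m x) (x : X) (f : WeightedL2 m) :
    inner ℂ (finsuppToL2 m (Finsupp.single x 1)) f = (m x : ℂ) * (f : X → ℂ) x := by
  let I : MeasurableSpace X := ⊤
  have hmx : MeasurableSet ({x} : Set X) := by trivial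
  have hf : weightMeasure m {x} ≠ ∞ := by
    rw [weightMeasure_singleton]; exact ENNReal.ofReal_ne_top
  have e : finsuppToL2 m (Finsupp.single x 1)
      = indicatorConstLp 2 (μ := weightMeasure m) hmx hf (1 : ℂ) := by
    apply Lp.ext
    refine (MemLp.coeFn_toLp (memLp_finsupp m (Finsupp.single x 1))).trans
      (EventuallyEq.trans (Eventually.of_forall fun y => ?_) indicatorConstLp_coeFn.symm)
    by_cases hy : y = x
    · subst hy; simp
    · simp [hy]
  rw [e, L2.inner_indicatorConstLp_one, integral_singleton, Measure.real,
    weightMeasure_singleton, ENNReal.toReal_ofReal (hm x).le, Complex.real_smul]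

lemma inner_finsuppToL2_single_finsuppToL2 (hm : ∀ x, 0 < m x) (x : X) (φ : X →₀ ℂ) :
    inner ℂ (finsuppToL2 m (Finsupp.single x 1)) (finsuppToL2 m φ) = (m x : ℂ) * φ x := by
  rw [inner_finsuppToL2_single hm]
  congr 1
  exact MagneticGraph.ae_weightMeasure hm (MemLp.coeFn_toLp (memLp_finsupp m φ)) x

lemma finsuppToL2_eq_sum (φ : X →₀ ℂ) :
    finsuppToL2 m φ = ∑ x ∈ φ.support, φ x • finsuppToL2 m (Finsupp.single x 1) := by
  conv_lhs => rw [← φ.sum_single, Finsupp.sum, map_sum]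
  refine Finset.sum_congr rfl fun x _ => ?_
  rw [← map_smul, Finsupp.smul_single, smul_eq_mul, mul_one]

lemma norm_finsuppToL2_sq (hm : ∀ x, 0 < m x) (φ : X →₀ ℂ) :
    ‖finsuppToL2 m φ‖ ^ 2 = ∑ x ∈ φ.support, m x * ‖φ x‖ ^ 2 := by
  have h : ((‖finsuppToL2 m φ‖ ^ 2 : ℝ) : ℂ) = ((∑ x ∈ φ.support, m x * ‖φ x‖ ^ 2 : ℝ) : ℂ) := by
    have h1 := inner_self_eq_norm_sq_to_K (𝕜 := ℂ) (finsuppToL2 m φ)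
    conv_lhs at h1 => lhs; rw [finsuppToL2_eq_sum]
    rw [sum_inner] at h1
    push_cast
    refine (Eq.trans ?_ h1).symm
    refine Finset.sum_congr rfl fun x _ => ?_
    rw [inner_smul_left, inner_finsuppToL2_single_finsuppToL2 hm, mul_left_comm, Complex.conj_mul']
  exact_mod_cast h

/-- The restriction of an element of `ℓ²(X, m)` to a finite set. -/
noncomputable def truncation (m : X → ℝ) (F : Finset X) : WeightedL2 m →L[ℂ] WeightedL2 m :=
  ∑ x ∈ F, ((m x : ℂ)⁻¹ • innerSL ℂ (finsuppToL2 m (Finsupp.single x 1))).smulRight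
    (finsuppToL2 m (Finsupp.single x 1))

lemma isCompactOperator_truncation (F : Finset X) : IsCompactOperator (truncation m F) := by
  classical
  unfold truncation
  induction F using Finset.induction_on with
  | empty => simpa using isCompactOperator_zero
  | insert x F hx ih =>
    rw [Finset.sum_insert hx]
    refine IsCompactOperator.add ?_ ih
    exact (isCompactOperator_of_locallyCompactSpace_rng (ContinuousLinearMap.toSpanSingleton ℂ
      (finsuppToL2 m (Finsupp.single x 1)))).comp_clm
      ((m x : ℂ)⁻¹ • innerSL ℂ (finsuppToL2 m (Finsupp.single x 1)))

lemma finsuppToL2_sub_truncation [DecidableEq X] (hm : ∀ x, 0 < m x) (F : Finset X) (φ : X →₀ ℂ) :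
    finsuppToL2 m φ - truncation m F (finsuppToL2 m φ)
      = finsuppToL2 m (φ.filter (· ∉ F)) := by
  have h1 : truncation m F (finsuppToL2 m φ)
      = finsuppToL2 m (∑ x ∈ F, Finsupp.single x (φ x)) := by
    rw [truncation, sum_apply, map_sum]
    refine Finset.sum_congr rfl fun x _ => ?_
    have hx : (m x : ℂ) ≠ 0 := by exact_mod_cast (hm x).ne'
    rw [ContinuousLinearMap.smulRight_apply, smul_apply, innerSL_apply_apply,
      inner_finsuppToL2_single_finsuppToL2 hm, smul_eq_mul, inv_mul_cancel_left₀ hx, ← map_smul,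
      Finsupp.smul_single, smul_eq_mul, mul_one]
  rw [h1, ← map_sub]
  congr 1
  ext y
  rw [Finsupp.sub_apply, Finsupp.finsetSum_apply, Finsupp.filter_apply]
  simp only [Finsupp.single_apply, Finset.sum_ite_eq']
  by_cases hy : y ∈ F <;> simp [hy]

end WeightedL2

/-! ### Energy completion, the inverse operator and its compactness -/

namespace MagneticGraph

variable {X : Type*} (G : MagneticGraph X)

/-- The Hilbert space completion of `C_c(X)` with respect to the form. -/
lemma exists_formDomain.{u} {X : Type u} (G : MagneticGraph X) (hq : ∀ x, 0 ≤ G.q x) :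
    ∃ (V : Type u) (_ : NormedAddCommGroup V) (_ : InnerProductSpace ℂ V) (_ : CompleteSpace V)
      (ι : (X →₀ ℂ) →ₗ[ℂ] V), DenseRange ι ∧
        ∀ ψ φ, inner ℂ (ι ψ) (ι φ) = G.compForm ψ φ := by
  let c : PreInnerProductSpace.Core ℂ (X →₀ ℂ) :=
    { inner := G.compForm
      conj_inner_symm := fun ψ φ => G.compForm_conj φ ψ
      re_inner_nonneg := fun φ => by
        rw [compForm_self]; exact G.energy_nonneg hq φ
      add_left := fun φ χ ψ => G.compForm_add_left ψ φ χ
      smul_left := fun φ ψ c => G.compForm_smul_left c ψ φ }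
  -- The energy is a priori only a seminorm; the completion also divides out its kernel.
  let _ : SeminormedAddCommGroup (X →₀ ℂ) := InnerProductSpace.Core.toSeminormedAddCommGroup (c := c)
  let _ : InnerProductSpace ℂ (X →₀ ℂ) := InnerProductSpace.ofCore c
  exact ⟨UniformSpace.Completion (X →₀ ℂ), inferInstance, inferInstance, inferInstance,
    (UniformSpace.Completion.toComplₗᵢ (𝕜 := ℂ) (E := X →₀ ℂ)).toLinearMap,
    UniformSpace.Completion.denseRange_coe, fun ψ φ => UniformSpace.Completion.inner_coe _ _⟩

/-- If the form domain embeds into `ℓ²(X, m)` through a bounded operator `J`, then the operator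
associated with the closed form is the inverse of `J J*`. -/
lemma mem_operatorGraph_iff (hq : ∀ x, 0 ≤ G.q x)
    {V : Type*} [NormedAddCommGroup V] [InnerProductSpace ℂ V] [CompleteSpace V]
    {ι : (X →₀ ℂ) →ₗ[ℂ] V} (hι : DenseRange ι)
    (hin : ∀ ψ φ, inner ℂ (ι ψ) (ι φ) = G.compForm ψ φ)
    {J : V →L[ℂ] WeightedL2 G.m} (hJ : ∀ φ, J (ι φ) = finsuppToL2 G.m φ)
    (f h : WeightedL2 G.m) :
    (f, h) ∈ G.operatorGraph hq ↔ f = J (ContinuousLinearMap.adjoint J h) := by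
  have hE : ∀ φ, G.energy φ = ‖ι φ‖ ^ 2 := fun φ => by
    have h1 := inner_self_eq_norm_sq_to_K (𝕜 := ℂ) (ι φ)
    rw [hin, compForm_self] at h1
    exact Complex.ofReal_injective (by rw [h1]; push_cast; rfl)
  -- Form-approximating sequences are Cauchy in energy, hence converge in `V`; continuity of `J`
  -- identifies the image of the limit.
  have happ : ∀ (φ : ℕ → X →₀ ℂ) (g : WeightedL2 G.m), G.FormApprox φ g →
      ∃ v, Tendsto (fun n => ι (φ n)) atTop (𝓝 v) ∧ J v = g := by
    intro φ g hφ
    have hc : CauchySeq fun n => ι (φ n) := by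
      rw [cauchySeq_iff_tendsto_dist_atTop_0]
      have := hφ.2.sqrt
      simpa [hE, dist_eq_norm, Real.sqrt_sq, map_sub] using this
    obtain ⟨v, hv⟩ := cauchySeq_tendsto_of_complete hc
    refine ⟨v, hv, tendsto_nhds_unique ?_ hφ.1⟩
    exact ((J.continuous.tendsto v).comp hv).congr fun n => hJ _
  constructor
  · rintro ⟨φ, hφ, hh⟩
    obtain ⟨v, hv, hJv⟩ := happ φ f hφ
    have hv' : v = ContinuousLinearMap.adjoint J h := by
      refine ext_inner_left ℂ fun w => ?_
      refine hι.induction_on w (isClosed_eq (by fun_prop) (by fun_prop)) fun ψ => ?_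
      rw [ContinuousLinearMap.adjoint_inner_right, hJ]
      refine tendsto_nhds_unique ?_ (hh _ _ (FormApprox.const ψ))
      simpa only [hin] using (tendsto_const_nhds (x := ι ψ)).inner (𝕜 := ℂ) hv
    rw [← hv', hJv]
  · rintro rfl
    obtain ⟨φ, hφ⟩ : ∃ φ : ℕ → X →₀ ℂ,
        Tendsto (fun n => ι (φ n)) atTop (𝓝 (ContinuousLinearMap.adjoint J h)) := by
      obtain ⟨x, hx, hlim⟩ := mem_closure_iff_seq_limit.mp (hι (ContinuousLinearMap.adjoint J h))
      choose φ hφ using hx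
      exact ⟨φ, by simpa only [hφ] using hlim⟩
    refine ⟨φ, ⟨?_, ?_⟩, fun g ψ hψ => ?_⟩
    · exact ((J.continuous.tendsto _).comp hφ).congr fun n => hJ _
    · have := (cauchySeq_iff_tendsto_dist_atTop_0.mp hφ.cauchySeq).pow 2
      simpa [hE, dist_eq_norm, map_sub] using this
    · obtain ⟨w, hw, hJw⟩ := happ ψ g hψ
      have := hw.inner (𝕜 := ℂ) hφ
      simp only [hin] at this
      rwa [ContinuousLinearMap.adjoint_inner_right, hJw] at this

/-- A Chebyshev estimate: `m ≤ δ m/μ` off `F`. Its uniformity over energy balls is the source of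
compactness. -/
lemma norm_finsuppToL2_filter_sq_le [DecidableEq X] {μ : X → ℝ} (hμ : ∀ x, 0 < μ x)
    {c : ℝ} (hc : 0 < c) (h : ∀ φ : X →₀ ℂ, c * ∑' x, G.m x / μ x * ‖φ x‖ ^ 2 ≤ G.energy φ)
    {δ : ℝ} (hδ : 0 ≤ δ) (F : Finset X) (hF : ∀ x, x ∉ F → μ x ≤ δ) (φ : X →₀ ℂ) :
    ‖finsuppToL2 G.m (φ.filter (· ∉ F))‖ ^ 2 ≤ δ / c * G.energy φ := by
  have h1 := h φ
  rw [tsum_eq_sum (s := φ.support) (fun x hx => by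
    have h : φ x = 0 := by simpa using hx
    simp [h])] at h1
  rw [norm_finsuppToL2_sq G.m_pos, Finsupp.support_filter, div_mul_eq_mul_div, le_div_iff₀ hc]
  refine le_trans ?_ (mul_le_mul_of_nonneg_left h1 hδ)
  rw [mul_comm, mul_left_comm]
  refine mul_le_mul_of_nonneg_left ?_ hc.le
  rw [Finset.mul_sum, Finset.sum_filter]
  refine Finset.sum_le_sum fun x _ => ?_
  have hm := G.m_pos x
  have hx := hμ x
  split_ifs with hxF
  · positivity
  · rw [Finsupp.filter_apply_pos (· ∉ F) _ hxF, ← mul_assoc]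
    refine mul_le_mul_of_nonneg_right ?_ (by positivity)
    rw [mul_div_assoc', le_div_iff₀ hx, mul_comm δ]
    exact mul_le_mul_of_nonneg_left (hF x hxF) hm.le

/-- If the form dominates `c m / μ` with `μ` vanishing at infinity, then the operator has purely
discrete spectrum. -/
theorem hasPurelyDiscreteSpectrum_of_form_bound (hq : ∀ x, 0 ≤ G.q x) {μ : X → ℝ}
    (hμ : ∀ x, 0 < μ x) (hμ₀ : Tendsto μ cofinite (𝓝 0)) {c : ℝ} (hc : 0 < c)
    (h : ∀ φ : X →₀ ℂ, c * ∑' x, G.m x / μ x * ‖φ x‖ ^ 2 ≤ G.energy φ) :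
    (G.hamiltonian hq).HasPurelyDiscreteSpectrum := by
  classical
  obtain ⟨V, _, _, _, ι, hι, hin⟩ := G.exists_formDomain hq
  have hE : ∀ φ, G.energy φ = ‖ι φ‖ ^ 2 := fun φ => by
    have h1 := inner_self_eq_norm_sq_to_K (𝕜 := ℂ) (ι φ)
    rw [hin, compForm_self] at h1
    exact Complex.ofReal_injective (by rw [h1]; push_cast; rfl)
  have htail : ∀ {δ : ℝ}, 0 ≤ δ → ∀ F : Finset X, (∀ x, x ∉ F → μ x ≤ δ) → ∀ φ : X →₀ ℂ,
      ‖finsuppToL2 G.m (φ.filter (· ∉ F))‖ ≤ √(δ / c) * ‖ι φ‖ := by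
    intro δ hδ F hF φ
    have h1 := G.norm_finsuppToL2_filter_sq_le hμ hc h hδ F hF φ
    rw [hE] at h1
    refine le_of_sq_le_sq ?_ (by positivity)
    rwa [mul_pow, Real.sq_sqrt (by positivity)]
  have hfin : ∀ {δ : ℝ}, 0 < δ → ∃ F : Finset X, ∀ x, x ∉ F → μ x ≤ δ := fun {δ} hδ => by
    have h1 := hμ₀.eventually_le_const hδ
    rw [eventually_cofinite] at h1
    exact ⟨h1.toFinset, fun x hx => by simpa using hx⟩
  obtain ⟨C, hC⟩ : ∃ C, ∀ φ, ‖finsuppToL2 G.m φ‖ ≤ C * ‖ι φ‖ := by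
    obtain ⟨F, hF⟩ := hfin one_pos
    have hpos : 0 ≤ ∑ x ∈ F, μ x := Finset.sum_nonneg fun x _ => (hμ x).le
    -- `1 + ∑_F μ` bounds `μ` everywhere, so the tail estimate with the empty set gives boundedness
    -- of the embedding.
    refine ⟨√((1 + ∑ x ∈ F, μ x) / c), fun φ => ?_⟩
    have h1 := htail (by linarith : 0 ≤ 1 + ∑ x ∈ F, μ x) ∅ (fun x _ => ?_) φ
    · have h2 : φ.filter (· ∉ (∅ : Finset X)) = φ :=
        φ.filter_eq_self_iff _ |>.mpr fun x _ => Finset.notMem_empty x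
      rwa [h2] at h1
    · by_cases hx : x ∈ F
      · linarith [Finset.single_le_sum (fun y _ => (hμ y).le) hx]
      · linarith [hF x hx]
  let J : V →L[ℂ] WeightedL2 G.m := (finsuppToL2 G.m).extendOfNorm ι
  have hJ : ∀ φ, J (ι φ) = finsuppToL2 G.m φ := LinearMap.extendOfNorm_eq hι ⟨C, hC⟩
  have hJc : IsCompactOperator J := by
    refine isCompactOperator_of_tendsto (F := fun F : Finset X => truncation G.m F ∘L J)
      (l := atTop) ?_ (Eventually.of_forall fun F => (isCompactOperator_truncation F).comp_clm J)
    rw [Metric.tendsto_atTop]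
    intro ε hε
    -- With this `δ` the tail constant `√(δ / c)` equals `ε / 2`.
    obtain ⟨F₀, hF₀⟩ := hfin (by positivity : 0 < c * (ε / 2) ^ 2)
    refine ⟨F₀, fun F hF => ?_⟩
    rw [dist_eq_norm, norm_sub_rev]
    refine lt_of_le_of_lt (ContinuousLinearMap.opNorm_le_bound _ (by positivity : 0 ≤ ε / 2) ?_)
      (half_lt_self hε)
    intro v
    refine hι.induction_on v (isClosed_le (by fun_prop) (by fun_prop)) fun φ => ?_
    have h1 := htail (by positivity : 0 ≤ c * (ε / 2) ^ 2) F (fun x hx => hF₀ x fun h => hx (hF h)) φ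
    rw [mul_div_cancel_left₀ _ hc.ne', Real.sqrt_sq (by positivity),
      ← finsuppToL2_sub_truncation G.m_pos] at h1
    simpa [hJ] using h1
  refine LinearPMap.hasPurelyDiscreteSpectrum_of_compact_inverse
    (R := J ∘L ContinuousLinearMap.adjoint J) (hJc.comp_clm _) ?_ fun f h => ?_
  · intro f g
    change inner ℂ (J (ContinuousLinearMap.adjoint J f)) g
      = inner ℂ f (J (ContinuousLinearMap.adjoint J g))
    rw [← ContinuousLinearMap.adjoint_inner_right, ContinuousLinearMap.adjoint_inner_left]
  · rw [hamiltonian_graph]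
    exact G.mem_operatorGraph_iff hq hι hin hJ f h

end MagneticGraph

/-! ### Magnetic sparseness implies a lower bound for the form -/

/-- A finite co-area formula: an inequality which is linear in the indicator functions of subsets
passes to nonnegative functions. -/
lemma Finset.sum_min_le_of_forall_subset {X : Type*} [DecidableEq X] (c : X → X → ℝ) (p : X → ℝ)
    (S : Finset X) (h : ∀ W ⊆ S, ∑ x ∈ W, ∑ y ∈ W, c x y ≤ ∑ x ∈ W, p x) :
    ∀ f : X → ℝ, (∀ x ∈ S, 0 ≤ f x) →
      ∑ x ∈ S, ∑ y ∈ S, c x y * min (f x) (f y) ≤ ∑ x ∈ S, p x * f x := by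
  induction S using Finset.strongInduction with
  | H S ih =>
    intro f hf
    rcases S.eq_empty_or_nonempty with rfl | hne
    · simp
    -- Peel off the lowest layer, `f = (f - f z) + f z`. The first part is nonnegative and vanishes
    -- at `z`, so induction on `S.erase z` applies; the constant layer is the hypothesis for `W =
    -- S`.
    obtain ⟨z, hz, hmin⟩ := S.exists_min_image f hne
    have h1 := ih (S.erase z) (Finset.erase_ssubset hz)
      (fun W hW => h W (hW.trans (Finset.erase_subset _ _))) (fun x => f x - f z)
      (fun x hx => sub_nonneg.mpr (hmin x (Finset.mem_of_mem_erase hx)))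
    have h2 := mul_le_mul_of_nonneg_right (h S subset_rfl) (hf z hz)
    have h3 : ∑ x ∈ S.erase z, p x * (f x - f z) = ∑ x ∈ S, p x * (f x - f z) :=
      Finset.sum_erase _ (by simp)
    have h4 : ∑ x ∈ S.erase z, ∑ y ∈ S.erase z, c x y * min (f x - f z) (f y - f z)
        = ∑ x ∈ S, ∑ y ∈ S, c x y * min (f x - f z) (f y - f z) := by
      rw [Finset.sum_erase]
      · refine Finset.sum_congr rfl fun x hx => Finset.sum_erase _ ?_
        simp [hmin x hx]
      · refine Finset.sum_eq_zero fun y hy => ?_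
        simp [hmin y (Finset.mem_of_mem_erase hy)]
    rw [h3, h4] at h1
    have h5 : ∑ x ∈ S, ∑ y ∈ S, c x y * min (f x) (f y)
        = ∑ x ∈ S, ∑ y ∈ S, c x y * min (f x - f z) (f y - f z)
          + (∑ x ∈ S, ∑ y ∈ S, c x y) * f z := by
      simp only [Finset.sum_mul, ← Finset.sum_add_distrib]
      refine Finset.sum_congr rfl fun x _ => Finset.sum_congr rfl fun y _ => ?_
      rw [min_sub_sub_right]; ring
    have h6 : ∑ x ∈ S, p x * f x = ∑ x ∈ S, p x * (f x - f z) + (∑ x ∈ S, p x) * f z := by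
      simp only [Finset.sum_mul, ← Finset.sum_add_distrib]
      exact Finset.sum_congr rfl fun x _ => by ring
    rw [h5, h6]
    exact add_le_add h1 h2

/-- A law of cosines separating the change of modulus from the change of phase. -/
lemma norm_sub_sq_of_norm_one {u v : ℂ} (hu : ‖u‖ = 1) (hv : ‖v‖ = 1) (r s : ℝ) :
    ‖(r : ℂ) * u - s * v‖ ^ 2 = (r - s) ^ 2 + r * s * ‖u - v‖ ^ 2 := by
  have hu' : u.re * u.re + u.im * u.im = 1 := by
    rw [← Complex.normSq_apply, ← Complex.sq_norm, hu, one_pow]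
  have hv' : v.re * v.re + v.im * v.im = 1 := by
    rw [← Complex.normSq_apply, ← Complex.sq_norm, hv, one_pow]
  simp only [Complex.sq_norm, Complex.normSq_apply, Complex.sub_re, Complex.sub_im, Complex.mul_re,
    Complex.mul_im, Complex.ofReal_re, Complex.ofReal_im]
  linear_combination (r ^ 2 - r * s) * hu' + (s ^ 2 - r * s) * hv'

/-- Let `d` be the last norm, `w = ‖u - v‖` and `s ≤ r`. The left side is `s² + (r+s)(r-s)/2`, and
the law of cosines gives `r - s ≤ d` and `s w ≤ d`. The second summand costs `(r+s)d/2`, and the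
missing `s² w/2` costs `s d/2 ≤ (r+s)d/4`; together `3/4`. -/
lemma half_add_sq_le {u v : ℂ} (hu : ‖u‖ = 1) (hv : ‖v‖ = 1) {r s : ℝ} (hr : 0 ≤ r) (hs : 0 ≤ s) :
    (r ^ 2 + s ^ 2) / 2 ≤ min (r ^ 2) (s ^ 2) * (1 - ‖u - v‖ / 2)
      + 3 / 4 * ((r + s) * ‖(r : ℂ) * u - s * v‖) := by
  wlog hrs : s ≤ r generalizing u v r s
  · have h := this hv hu hs hr (not_le.mp hrs).le
    rw [min_comm, norm_sub_rev v, norm_sub_rev (_ * v), add_comm s, add_comm (s ^ 2)] at h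
    exact h
  have hd := norm_sub_sq_of_norm_one hu hv r s
  set d := ‖(r : ℂ) * u - s * v‖
  set w := ‖u - v‖
  have hw : 0 ≤ w := norm_nonneg _
  have hd0 : 0 ≤ d := norm_nonneg _
  have h1 : r - s ≤ d := by
    refine le_of_sq_le_sq ?_ hd0
    rw [hd]; nlinarith [mul_nonneg (mul_nonneg hr hs) (sq_nonneg w)]
  have h2 : s * w ≤ d := by
    refine le_of_sq_le_sq ?_ hd0
    rw [hd]
    nlinarith [mul_nonneg (mul_nonneg hs (sub_nonneg.mpr hrs)) (sq_nonneg w), sq_nonneg (r - s)]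
  rw [min_eq_right (by gcongr)]
  nlinarith [mul_le_mul_of_nonneg_left h1 (add_nonneg hr hs), mul_le_mul_of_nonneg_left h2 hs,
    mul_nonneg (sub_nonneg.mpr hrs) hd0]

/-! ### From sparseness to the degree bound and the spectral gap -/

namespace MagneticGraph

variable {X : Type*} (G : MagneticGraph X)

lemma frustration_one_le (W : Finset X) (τ : X → Circle) :
    G.frustration 1 W ≤
      (1 / 2) * ∑ x ∈ W, ∑ y ∈ W, G.b x y * ‖(τ x : ℂ) - G.phase x y * (τ y : ℂ)‖ := by
  refine (ciInf_le ⟨0, ?_⟩ (fun x : W => τ x)).trans_eq ?_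
  · rintro _ ⟨τ, rfl⟩
    refine mul_nonneg (by norm_num) (Finset.sum_nonneg fun x _ => Finset.sum_nonneg fun y _ => ?_)
    exact mul_nonneg (G.b_nonneg _ _) (by positivity)
  · simp only [Real.rpow_one]
    congr 1
    rw [← Finset.sum_coe_sort W]
    exact Finset.sum_congr rfl fun x _ => Finset.sum_coe_sort W
      fun y => G.b x y * ‖(τ x : ℂ) - G.phase x y * (τ y : ℂ)‖

/-- By symmetry of `b` both halves of `∂W` carry the same mass. The subtracted term is what raises
the coefficient of `b(W×W)` in the sparseness inequality to `1 + a`. -/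
lemma half_sum_boundary (W : Finset X) :
    (1 / 2) * (∑' e : boundary (W : Set X), G.b (e : X × X).1 (e : X × X).2)
      = ∑ x ∈ W, (∑' y, G.b x y) - ∑ x ∈ W, ∑ y ∈ W, G.b x y := by
  classical
  have hL : HasSum (fun e : X × X => if e.1 ∈ W ∧ e.2 ∉ W then G.b e.1 e.2 else 0)
      (∑ x ∈ W, (∑' y, G.b x y) - ∑ x ∈ W, ∑ y ∈ W, G.b x y) := by
    have hsub : ∀ x, HasSum (fun y => if y ∈ W then 0 else G.b x y)
        ((∑' y, G.b x y) - ∑ y ∈ W, G.b x y) := fun x => by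
      have h1 : HasSum (fun y => if y ∈ W then G.b x y else 0) (∑ y ∈ W, G.b x y) := by
        rw [Finset.sum_congr rfl (g := fun y => if y ∈ W then G.b x y else 0)
          (fun y hy => by simp [hy])]
        exact hasSum_sum_of_ne_finset_zero (fun y hy => by simp [hy])
      refine ((G.b_summable x).hasSum.sub h1).congr_fun ?_
      intro y; by_cases hy : y ∈ W <;> simp [hy]
    have hx : ∀ x, HasSum (fun y => if x ∈ W ∧ y ∉ W then G.b x y else 0)
        (if x ∈ W then (∑' y, G.b x y) - ∑ y ∈ W, G.b x y else 0) := fun x => by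
      by_cases hx : x ∈ W
      · simpa [hx] using hsub x
      · simp [hx]
    have hsum : Summable (fun e : X × X => if e.1 ∈ W ∧ e.2 ∉ W then G.b e.1 e.2 else 0) := by
      rw [summable_prod_of_nonneg]
      · refine ⟨fun x => (hx x).summable, ?_⟩
        refine summable_of_ne_finset_zero (s := W) fun x hxW => ?_
        simp [hxW]
      · intro e
        dsimp only
        split_ifs
        · exact G.b_nonneg _ _
        · exact le_rfl
    convert hsum.hasSum using 1
    rw [hsum.tsum_prod, tsum_congr fun x => (hx x).tsum_eq, tsum_eq_sum (s := W)]
    · rw [← Finset.sum_sub_distrib]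
      exact Finset.sum_congr rfl fun x hx => by simp [hx]
    · intro x hx; simp [hx]
  have hR := (Equiv.prodComm X X).hasSum_iff.mpr hL
  have hB : HasSum (fun e : boundary (W : Set X) => G.b (e : X × X).1 (e : X × X).2)
      ((∑ x ∈ W, (∑' y, G.b x y) - ∑ x ∈ W, ∑ y ∈ W, G.b x y)
        + (∑ x ∈ W, (∑' y, G.b x y) - ∑ x ∈ W, ∑ y ∈ W, G.b x y)) := by
    refine (hasSum_subtype_iff_indicator (f := fun e : X × X => G.b e.1 e.2)).mpr ?_
    refine (hL.add hR).congr_fun ?_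
    rintro ⟨x, y⟩
    by_cases hx : x ∈ W <;> by_cases hy : y ∈ W <;>
      simp [boundary, Set.indicator, hx, hy, G.b_symm x y]
  rw [hB.tsum_eq]; ring

lemma norm_mul_exp_arg (z : ℂ) : ((‖z‖ : ℝ) : ℂ) * (Circle.exp z.arg : ℂ) = z := by
  rw [Circle.coe_exp, Complex.norm_mul_exp_arg_mul_I]

lemma tsum_left (φ : X →₀ ℂ) :
    ∑' e : X × X, G.b e.1 e.2 * ‖φ e.1‖ ^ 2 = ∑ x ∈ φ.support, (∑' y, G.b x y) * ‖φ x‖ ^ 2 := by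
  rw [(G.summable_left φ).tsum_prod, tsum_eq_sum (s := φ.support)]
  · exact Finset.sum_congr rfl fun x _ => (G.b_summable x).tsum_mul_right (‖φ x‖ ^ 2)
  · intro x hx
    have h : φ x = 0 := by simpa using hx
    simp [h]

lemma tsum_right (φ : X →₀ ℂ) :
    ∑' e : X × X, G.b e.1 e.2 * ‖φ e.2‖ ^ 2 = ∑ x ∈ φ.support, (∑' y, G.b x y) * ‖φ x‖ ^ 2 := by
  rw [← tsum_left, ← (Equiv.prodComm X X).tsum_eq]
  exact tsum_congr fun e => by simp [G.b_symm e.1 e.2]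

lemma energy_eq_sum (φ : X →₀ ℂ) :
    G.energy φ = (1 / 2) * (∑' e : X × X, G.b e.1 e.2 * ‖G.diff φ e‖ ^ 2)
      + ∑ x ∈ φ.support, G.q x * G.m x * ‖φ x‖ ^ 2 := by
  unfold energy
  congr 1
  rw [tsum_eq_sum (s := φ.support)]
  · exact Finset.sum_congr rfl fun x _ => by ring
  · intro x hx
    have h : φ x = 0 := by simpa using hx
    simp [h]

/-- The form of an `(a, 0)₁`-magnetic-sparse graph dominates the weighted degree. -/
theorem IsMagneticSparse.sum_degree_le {G : MagneticGraph X} (hq : ∀ x, 0 ≤ G.q x) {a : ℝ}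
    (ha : 0 ≤ a) (h : G.IsMagneticSparse a 0 1) (φ : X →₀ ℂ) :
    ∑ x ∈ φ.support, ((∑' y, G.b x y) + G.q x * G.m x) * ‖φ x‖ ^ 2
      ≤ 9 / 2 * (1 + a) ^ 2 * G.energy φ := by
  classical
  -- At zeros of `φ` this is the default phase `1`, harmless since it is always multiplied by `‖φ x‖
  -- = 0`.
  set τ : X → Circle := fun x => Circle.exp (φ x).arg with hτ
  set w : X → X → ℝ := fun x y => ‖(τ x : ℂ) - G.phase x y * (τ y : ℂ)‖ with hw
  set S := φ.support
  have hco := S.sum_min_le_of_forall_subset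
    (fun x y => (1 + a) * (G.b x y * (1 - w x y / 2)))
    (fun x => a * ((∑' y, G.b x y) + G.q x * G.m x))
    (fun W _ => by
      have h1 := h W
      have h2 := mul_le_mul_of_nonneg_left (G.frustration_one_le W τ) (by linarith : 0 ≤ 1 + a)
      have h0 : ∀ x, max (G.q x) 0 = G.q x := fun x => max_eq_left (hq x)
      simp only [half_sum_boundary, h0] at h1
      have h3 : ∑ x ∈ W, ∑ y ∈ W, (1 + a) * (G.b x y * (1 - w x y / 2))
          = (1 + a) * (∑ x ∈ W, ∑ y ∈ W, G.b x y
            - (1 / 2) * ∑ x ∈ W, ∑ y ∈ W, G.b x y * w x y) := by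
        simp only [Finset.mul_sum, ← Finset.sum_sub_distrib]
        exact Finset.sum_congr rfl fun x _ => Finset.sum_congr rfl fun y _ => by ring
      rw [h3, ← Finset.mul_sum, Finset.sum_add_distrib]
      linarith)
    (fun x => ‖φ x‖ ^ 2) (fun x _ => by positivity)
  -- The minimum vanishes off `S × S`, so the finite sum extends to all pairs and can be compared
  -- edge by edge.
  have hM : HasSum (fun e : X × X => (1 + a) * (G.b e.1 e.2 * (1 - w e.1 e.2 / 2))
      * min (‖φ e.1‖ ^ 2) (‖φ e.2‖ ^ 2))
      (∑ x ∈ S, ∑ y ∈ S, (1 + a) * (G.b x y * (1 - w x y / 2)) * min (‖φ x‖ ^ 2) (‖φ y‖ ^ 2)) := by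
    rw [← Finset.sum_product' S S (fun x y => (1 + a) * (G.b x y * (1 - w x y / 2))
      * min (‖φ x‖ ^ 2) (‖φ y‖ ^ 2))]
    refine hasSum_sum_of_ne_finset_zero fun e he => ?_
    rw [Finset.mem_product, not_and_or] at he
    rcases he with he | he
    · have h0 : φ e.1 = 0 := by simpa [S] using he
      simp [h0]
    · have h0 : φ e.2 = 0 := by simpa [S] using he
      simp [h0]
  have hL := (G.summable_left φ).hasSum
  have hR := (G.summable_right φ).hasSum
  have hD := (G.summable_diff_sq φ).hasSum
  rw [tsum_left] at hL
  rw [tsum_right] at hR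
  -- Write `N`, `P` for the degree and potential sums and `D` for the edge sum. This yields `(1+a) N
  -- ≤ M + N/2 + 9/8 (1+a)² D`, and `hco` gives `M ≤ a (N + P)`. Hence `N ≤ 2 a P + 9/4 (1+a)² D`,
  -- where `D` is twice the edge energy; adding `P` and using `2 a + 1 ≤ 9/2 (1+a)²` finishes.
  have hle := hasSum_le (fun e => ?_) ((hL.add hR).mul_left ((1 + a) / 2))
    ((hM.add ((hL.add hR).mul_left (1 / 4))).add (hD.mul_left (9 / 8 * (1 + a) ^ 2)))
  · rw [energy_eq_sum]
    have h4 : ∑ x ∈ S, a * ((∑' y, G.b x y) + G.q x * G.m x) * ‖φ x‖ ^ 2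
        = a * (∑ x ∈ S, (∑' y, G.b x y) * ‖φ x‖ ^ 2 + ∑ x ∈ S, G.q x * G.m x * ‖φ x‖ ^ 2) := by
      simp only [Finset.mul_sum, ← Finset.sum_add_distrib]
      exact Finset.sum_congr rfl fun x _ => by ring
    rw [h4] at hco
    simp only [add_mul, Finset.sum_add_distrib]
    have hP : 0 ≤ ∑ x ∈ S, G.q x * G.m x * ‖φ x‖ ^ 2 := Finset.sum_nonneg fun x _ =>
      mul_nonneg (mul_nonneg (hq x) (G.m_pos x).le) (by positivity)
    have h5 : (2 * a + 1) * (∑ x ∈ S, G.q x * G.m x * ‖φ x‖ ^ 2)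
        ≤ 9 / 2 * (1 + a) ^ 2 * (∑ x ∈ S, G.q x * G.m x * ‖φ x‖ ^ 2) :=
      mul_le_mul_of_nonneg_right (by nlinarith) hP
    linarith
  · have h1 := half_add_sq_le (u := (τ e.1 : ℂ)) (v := G.phase e.1 e.2 * (τ e.2 : ℂ))
      (Circle.norm_coe _) (by rw [norm_mul, norm_phase, Circle.norm_coe, one_mul])
      (norm_nonneg (φ e.1)) (norm_nonneg (φ e.2))
    have h2 : ((‖φ e.1‖ : ℝ) : ℂ) * (τ e.1 : ℂ) - ((‖φ e.2‖ : ℝ) : ℂ) *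
        (G.phase e.1 e.2 * (τ e.2 : ℂ)) = G.diff φ e := by
      rw [mul_left_comm, norm_mul_exp_arg, norm_mul_exp_arg]; rfl
    rw [h2] at h1
    have hb := G.b_nonneg e.1 e.2
    generalize ‖φ e.1‖ = r, ‖φ e.2‖ = s, ‖G.diff φ e‖ = d at *
    -- Young's inequality from the square of `(r+s) - 3(1+a)d`, weighted by `1/8`, together with
    -- `(r+s)² ≤ 2(r²+s²)`.
    have h3 : (1 + a) * (3 / 4 * ((r + s) * d))
        ≤ 1 / 4 * (r ^ 2 + s ^ 2) + 9 / 8 * (1 + a) ^ 2 * d ^ 2 := by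
      nlinarith [sq_nonneg (r - s), sq_nonneg ((r + s) - 3 * (1 + a) * d)]
    have h4 := mul_le_mul_of_nonneg_left h1 (mul_nonneg hb (by linarith : 0 ≤ 1 + a))
    have h5 := mul_le_mul_of_nonneg_left h3 hb
    simp only [hw]
    linarith

/-- The spectral gap of a magnetic-sparse graph with weighted degree bounded below. -/
theorem IsMagneticSparse.exists_spectral_gap {G : MagneticGraph X} (hq : ∀ x, 0 ≤ G.q x) {a : ℝ}
    (ha : 0 ≤ a) (h : G.IsMagneticSparse a 0 1) (hDeg : ∃ D : ℝ, 0 < D ∧ ∀ x, D ≤ G.Deg x) :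
    ∃ c : ℝ, 0 < c ∧ ∀ φ : X →₀ ℂ, c * ∑' x, G.m x * ‖φ x‖ ^ 2 ≤ G.energy φ := by
  obtain ⟨D, hD, hDx⟩ := hDeg
  have hC : 0 < 9 / 2 * (1 + a) ^ 2 := by positivity
  refine ⟨D / (9 / 2 * (1 + a) ^ 2), by positivity, fun φ => ?_⟩
  rw [tsum_eq_sum (s := φ.support) (fun x hx => by
    have h : φ x = 0 := by simpa using hx
    simp [h]), div_mul_eq_mul_div, div_le_iff₀' hC, Finset.mul_sum]
  refine (Finset.sum_le_sum fun x _ => ?_).trans (h.sum_degree_le hq ha φ)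
  rw [← mul_assoc]
  refine mul_le_mul_of_nonneg_right ?_ (by positivity)
  have hm := G.m_pos x
  refine (mul_le_mul_of_nonneg_right (hDx x) hm.le).trans_eq ?_
  unfold Deg
  field_simp

end MagneticGraph

/-! ### Products -/

lemma summable_mul_norm_sq {X : Type*} (c : X → ℝ) (φ : X →₀ ℂ) :
    Summable fun x => c x * ‖φ x‖ ^ 2 := by
  refine summable_of_ne_finset_zero (s := φ.support) fun x hx => ?_
  have h : φ x = 0 := by simpa using hx
  simp [h]

namespace MagneticGraph

variable {X₁ X₂ : Type*} (G₁ : MagneticGraph X₁) (G₂ : MagneticGraph X₂)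
  {μ : X₁ × X₂ → ℝ} (hμ : ∀ x, 0 < μ x)

lemma prod_edge_fiber (φ : X₁ × X₂ →₀ ℂ) (x : X₁) (e : X₂ × X₂) :
    (G₁.prod G₂ μ hμ).b (x, e.1) (x, e.2) * ‖(G₁.prod G₂ μ hμ).diff φ ((x, e.1), (x, e.2))‖ ^ 2
      = G₁.m x * (G₂.b e.1 e.2 * ‖G₂.diff (φ.curry x) e‖ ^ 2) := by
  -- On a loop the product phase mixes both potentials, but the edge weight vanishes there.
  by_cases he : e.1 = e.2
  · simp [prod, he, G₁.b_diag, G₂.b_diag]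
  · simp only [prod, diff, phase, if_neg he, Finsupp.curry_apply, if_true]
    rw [zero_add]
    ring

/-- The form of a product dominates the forms of the fibers. -/
lemma tsum_energy_fiber_le (hq₁ : ∀ x, 0 ≤ G₁.q x) (φ : X₁ × X₂ →₀ ℂ) :
    Summable (fun x => G₁.m x * G₂.energy (φ.curry x)) ∧
    ∑' x, G₁.m x * G₂.energy (φ.curry x) ≤ (G₁.prod G₂ μ hμ).energy φ := by
  set G := G₁.prod G₂ μ hμ
  -- These are the pairs inside a common fiber; discarding all others only lowers the edge energy.
  let i : X₁ × (X₂ × X₂) → (X₁ × X₂) × (X₁ × X₂) := fun p => ((p.1, p.2.1), (p.1, p.2.2))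
  have hi : Function.Injective i := by
    rintro ⟨x, y, z⟩ ⟨x', y', z'⟩ h
    simp only [i, Prod.mk.injEq] at h
    simp [h.1.1, h.1.2, h.2.2]
  have hs := G.summable_diff_sq φ
  have hsi := hs.comp_injective hi
  have hle := tsum_comp_le_tsum_of_inj hs
    (fun e => mul_nonneg (G.b_nonneg _ _) (by positivity)) hi
  have hfib : ∀ x, ∑' e : X₂ × X₂,
      ((fun e : (X₁ × X₂) × (X₁ × X₂) => G.b e.1 e.2 * ‖G.diff φ e‖ ^ 2) ∘ i) (x, e)
      = G₁.m x * ∑' e : X₂ × X₂, G₂.b e.1 e.2 * ‖G₂.diff (φ.curry x) e‖ ^ 2 := fun x => by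
    rw [← tsum_mul_left]
    exact tsum_congr fun e => prod_edge_fiber G₁ G₂ hμ φ x e
  have hse := hsi.prod
  rw [funext hfib] at hse
  rw [hsi.tsum_prod, tsum_congr hfib] at hle
  have hv := summable_mul_norm_sq (fun x : X₁ × X₂ => G₁.m x.1 * (G₂.q x.2 * G₂.m x.2)) φ
  have hvfib : ∀ x, ∑' y, G₁.m x * (G₂.q y * G₂.m y) * ‖φ (x, y)‖ ^ 2
      = G₁.m x * ∑' y, G₂.q y * ‖φ.curry x y‖ ^ 2 * G₂.m y := fun x => by
    rw [← tsum_mul_left]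
    exact tsum_congr fun y => by rw [Finsupp.curry_apply]; ring
  have hsv := hv.prod
  rw [funext hvfib] at hsv
  have hvle : ∑' x, G₁.m x * ∑' y, G₂.q y * ‖φ.curry x y‖ ^ 2 * G₂.m y
      ≤ ∑' x, G.q x * ‖φ x‖ ^ 2 * G.m x := by
    rw [← tsum_congr hvfib, ← hv.tsum_prod]
    refine hv.tsum_le_tsum (fun x => ?_)
      ((summable_mul_norm_sq (fun x => G.q x * G.m x) φ).congr fun x => by ring)
    have hx := hμ x
    -- The weight `μ` cancels between potential and measure, and the `q₁` part can be dropped by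
    -- nonnegativity.
    have h1 : G.q x * ‖φ x‖ ^ 2 * G.m x
        = G₁.q x.1 * (G₁.m x.1 * G₂.m x.2 * ‖φ x‖ ^ 2)
          + G₁.m x.1 * (G₂.q x.2 * G₂.m x.2) * ‖φ x‖ ^ 2 := by
      simp only [G, prod]
      field_simp
    rw [h1]
    have h2 := mul_pos (G₁.m_pos x.1) (G₂.m_pos x.2)
    have h3 := mul_nonneg (hq₁ x.1) (mul_nonneg h2.le (sq_nonneg ‖φ x‖))
    linarith
  have hsum := (hse.mul_left (1 / 2)).add hsv
  have hE : ∀ x, (1 / 2) * (G₁.m x * ∑' e : X₂ × X₂, G₂.b e.1 e.2 * ‖G₂.diff (φ.curry x) e‖ ^ 2)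
      + G₁.m x * ∑' y, G₂.q y * ‖φ.curry x y‖ ^ 2 * G₂.m y = G₁.m x * G₂.energy (φ.curry x) :=
    fun x => by unfold energy; ring
  refine ⟨hsum.congr hE, ?_⟩
  rw [← tsum_congr hE, (hse.mul_left (1 / 2)).tsum_add hsv, tsum_mul_left]
  exact add_le_add (mul_le_mul_of_nonneg_left hle (by norm_num)) hvle

/-- A spectral gap of the second factor bounds the form of the product from below. -/
lemma prod_form_bound (hq₁ : ∀ x, 0 ≤ G₁.q x) {c : ℝ}
    (hc : ∀ φ : X₂ →₀ ℂ, c * ∑' x, G₂.m x * ‖φ x‖ ^ 2 ≤ G₂.energy φ) (φ : X₁ × X₂ →₀ ℂ) :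
    c * ∑' x, (G₁.prod G₂ μ hμ).m x / μ x * ‖φ x‖ ^ 2 ≤ (G₁.prod G₂ μ hμ).energy φ := by
  obtain ⟨hs, hle⟩ := tsum_energy_fiber_le G₁ G₂ hμ hq₁ φ
  refine le_trans ?_ hle
  have hm : ∀ x, (G₁.prod G₂ μ hμ).m x / μ x * ‖φ x‖ ^ 2
      = G₁.m x.1 * G₂.m x.2 * ‖φ x‖ ^ 2 := fun x => by
    have hx := hμ x
    simp only [prod]
    field_simp
  have hv := summable_mul_norm_sq (fun x : X₁ × X₂ => G₁.m x.1 * G₂.m x.2) φ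
  have hfib : ∀ x, ∑' y, G₁.m x * G₂.m y * ‖φ (x, y)‖ ^ 2
      = G₁.m x * ∑' y, G₂.m y * ‖φ.curry x y‖ ^ 2 := fun x => by
    rw [← tsum_mul_left]
    exact tsum_congr fun y => by rw [Finsupp.curry_apply]; ring
  have hsv := hv.prod
  rw [funext hfib] at hsv
  rw [tsum_congr hm, hv.tsum_prod, tsum_congr hfib, ← tsum_mul_left]
  refine (hsv.mul_left c).tsum_le_tsum (fun x => ?_) hs
  rw [mul_left_comm]
  exact mul_le_mul_of_nonneg_left (hc _) (G₁.m_pos x).le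

end MagneticGraph

theorem mainTheorem4 {X₁ X₂ : Type*} (G₁ : MagneticGraph X₁) (G₂ : MagneticGraph X₂)
    (hq₁ : ∀ x, 0 ≤ G₁.q x) (hq₂ : ∀ x, 0 ≤ G₂.q x)
    (a : ℝ) (ha : 0 ≤ a) (hsparse : G₂.IsMagneticSparse a 0 1)
    (hDeg : ∃ D : ℝ, 0 < D ∧ ∀ x, D ≤ G₂.Deg x)
    (μ : X₁ × X₂ → ℝ) (hμ : ∀ x, 0 < μ x) (hμ₀ : Tendsto μ cofinite (𝓝 0)) :
    ((G₁.prod G₂ μ hμ).hamiltonian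
      (MagneticGraph.prod_q_nonneg hq₁ hq₂ hμ)).HasPurelyDiscreteSpectrum := by
  obtain ⟨c, hc, hgap⟩ := hsparse.exists_spectral_gap hq₂ ha hDeg
  exact MagneticGraph.hasPurelyDiscreteSpectrum_of_form_bound _ _ hμ hμ₀ hc
    (MagneticGraph.prod_form_bound G₁ G₂ hμ hq₁ hgap)
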